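/- Let $\Gamma=(V,E)$ be a finite digraph without loops or multiple edges, with at least two vertices, which is strongly connected, and let $\partial(u,v)$ denote the length of a shortest directed path from $u$ to $v$. Assume that $\Gamma$ is distance-regular, i.e. for every $l\ge 1$ and all $0\le i\le l+1$, the number of vertices $w$ with $\partial(u,w)=i$ and $\partial(v,w)=1$ is the same for all pairs $(u,v)$ of vertices with $\partial(u,v)=l$. An edge cut of $\Gamma$ is a set $F\subseteq E$ such that $\Gamma-F$ is not strongly connected; the edge connectivity of $\Gamma$ is the minimum size of an edge cut. Then $\Gamma$ is regular, i.e. there is a number $k$ (the valency) such that every vertex has in-degree and out-degree $k$, and the edge connectivity of $\Gamma$ equals $k$. Moreover, if $\Gamma$ is not an undirected cycle (a cycle on $n\ge 3$ vertices with every edge present in both directions), then every edge cut of minimum size is either the set of all edges going into a single vertex or the set of all edges coming out of a single vertex. -/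

import Mathlib

/-- There is a (directed) walk of length `n` from `u` to `v`. -/
def Digraph.HasWalk {V : Type*} (G : Digraph V) : ℕ → V → V → Prop
  | 0, u, v => u = v
  | n + 1, u, v => ∃ w, G.Adj u w ∧ G.HasWalk n w v

/-- The digraph is (strongly) connected: every vertex can be reached from every vertex. -/
def Digraph.IsStronglyConnected {V : Type*} (G : Digraph V) : Prop :=
  ∀ u v, ∃ n, G.HasWalk n u v

/-- The directed distance from `u` to `v`: the length of a shortest walk from `u` to `v`
(only used for strongly connected digraphs, where such a walk exists). -/
noncomputable def Digraph.ddist {V : Type*} (G : Digraph V) (u v : V) : ℕ :=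
  sInf {n | G.HasWalk n u v}

/-- The directed shell: the set of vertices at distance `i` from `u`. -/
def Digraph.outShell {V : Type*} (G : Digraph V) (i : ℕ) (u : V) : Set V :=
  {w | G.ddist u w = i}

/-- The in-degree and the out-degree of each vertex are equal to `k`. -/
def Digraph.IsRegularOfValency {V : Type*} (G : Digraph V) (k : ℕ) : Prop :=
  ∀ v, {w | G.Adj v w}.ncard = k ∧ {w | G.Adj w v}.ncard = k

/-- A simple (loopless), strongly connected digraph is distance-regular if, for all `u`, `v` at
distance `l ≥ 1` and all `0 ≤ i ≤ l + 1`, the number of vertices at distance `i` from `u` and at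
distance `1` from `v` depends only on `l` and `i`. -/
structure Digraph.IsDistanceRegular {V : Type*} (G : Digraph V) : Prop where
  loopless : ∀ v, ¬ G.Adj v v
  stronglyConnected : G.IsStronglyConnected
  card_inter_eq : ∀ l i : ℕ, 1 ≤ l → i ≤ l + 1 → ∀ u v u' v' : V,
    G.ddist u v = l → G.ddist u' v' = l →
      (G.outShell i u ∩ G.outShell 1 v).ncard = (G.outShell i u' ∩ G.outShell 1 v').ncard

/-- The set of edges (arcs) of a digraph. -/
def Digraph.arcSet {V : Type*} (G : Digraph V) : Set (V × V) := {e | G.Adj e.1 e.2}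

/-- The digraph obtained by removing a set of edges, keeping all vertices. -/
def Digraph.removeArcs {V : Type*} (G : Digraph V) (F : Set (V × V)) : Digraph V where
  Adj u v := G.Adj u v ∧ (u, v) ∉ F

/-- `F` is an edge cut: a set of edges whose removal leaves a digraph that is not strongly
connected. -/
def Digraph.IsEdgeCut {V : Type*} (G : Digraph V) (F : Set (V × V)) : Prop :=
  F ⊆ G.arcSet ∧ ¬ (G.removeArcs F).IsStronglyConnected

/-- An edge cut of minimum size. -/
def Digraph.IsMinEdgeCut {V : Type*} (G : Digraph V) (F : Set (V × V)) : Prop :=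
  G.IsEdgeCut F ∧ ∀ F', G.IsEdgeCut F' → F.ncard ≤ F'.ncard

/-- The edge connectivity: the size of a minimum edge cut (an edge cut exists as soon as there are
two distinct vertices). -/
noncomputable def Digraph.edgeConnectivity {V : Type*} (G : Digraph V) : ℕ :=
  sInf {m | ∃ F, G.IsEdgeCut F ∧ F.ncard = m}

/-- The set of all edges coming out of `x`. -/
def Digraph.outArcs {V : Type*} (G : Digraph V) (x : V) : Set (V × V) :=
  {e | e ∈ G.arcSet ∧ e.1 = x}

/-- The set of all edges going into `x`. -/
def Digraph.inArcs {V : Type*} (G : Digraph V) (x : V) : Set (V × V) :=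
  {e | e ∈ G.arcSet ∧ e.2 = x}

/-- The digraph is an undirected cycle with `n ≥ 3` vertices (each edge of the cycle being
present in both directions). -/
def Digraph.IsUndirectedCycle {V : Type*} (G : Digraph V) : Prop :=
  ∃ n : ℕ, 3 ≤ n ∧ ∃ e : V ≃ Fin n,
    ∀ u v, G.Adj u v ↔ (SimpleGraph.cycleGraph n).Adj (e u) (e v)

/-!
Let `k` be the valency of the distance-regular digraph and `n` the number of vertices.

**Algebra.** Let `M` be the transposed adjacency matrix and `distSpace G` the space of matrices whose
`(u, v)` entry depends only on the distance from `u` to `v`. Distance-regularity says that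
`distSpace G` is closed under right multiplication by `M`, so it contains all powers of `M`. As many
of these are linearly independent as there are distances, so `distSpace G` consists of the
polynomials in `M` (`exists_aeval_eq`); in particular it is a commutative algebra. Hence in-degrees
equal out-degrees (`card_inNbrs_eq`), and besides the forward intersection numbers `b i`, which the
definition provides, there are well-defined backward ones `c i` (`card_filter_inNbrs_eq`). Along
geodesics one sees that `b` decreases and `c` increases.

**Expansion.** Suppose all out-neighbours of some `a ∈ A` lie in `A`, and let `β i` be the number of
vertices outside `A` at distance `i` from `a`, so `β 0 = β 1 = 0`. Then
`c (i + 1) * β (i + 1) ≤ b i * β i + t (i + 1)`, where `t (i + 1)` counts the edges that leave `A`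
between the layers `i` and `i + 1`. Summing with the weights `w` given by
`c i * w i = 1 + b i * w (i + 1)`, which decrease, yields `|Aᶜ| ≤ e * w 2` for the number `e` of edges
leaving `A`; the same computation for entire layers gives `b 1 * k * w 2 = n - 1 - k`. So
`|Aᶜ| * b 1 * k ≤ e * (n - 1 - k)` (`card_compl_mul_le`).

**Small cuts.** Let `e ≤ k` edges leave `A`; equally many leave `Aᶜ`. Suppose that both sets have at
least two vertices. If every vertex of one side has an out-neighbour on the other side, then that
side is a clique of size `k` with exactly one outgoing edge at each vertex
(`clique_of_cutSize_le`), and `b 1 ≤ 1`. Otherwise the expansion bound holds for both sides, and its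
sum is contradictory for `b 1 ≥ 2`. If `b 1 = 0`, the digraph is complete. If `b 1 = 1` and `k ≥ 2`,
all edges are present in both directions (`symm_of_forwardNum_eq_one`), and either `k = 2` and the
digraph is an undirected cycle, or `k ≥ 3`, and there are at most `k + 2` vertices
(`card_le_of_forwardNum_eq_one`), too few for such a cut. The case `k = 1` is immediate, since a
single edge is then the set of all edges out of its tail.
-/

/-! ### Walks, distances and the out-degree -/

namespace Digraph

open scoped Classical

variable {V : Type*} {G : Digraph V}

theorem HasWalk.trans {m n : ℕ} {u v w : V} (h₁ : G.HasWalk m u v) (h₂ : G.HasWalk n v w) :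
    G.HasWalk (m + n) u w := by
  induction m generalizing u with
  | zero => obtain rfl : u = v := h₁; simpa using h₂
  | succ m ih =>
    obtain ⟨x, hx, hxv⟩ := h₁
    rw [Nat.add_right_comm]
    exact ⟨x, hx, ih hxv⟩

theorem hasWalk_one {u v : V} : G.HasWalk 1 u v ↔ G.Adj u v := by
  simp [HasWalk]

theorem HasWalk.exists_last {n : ℕ} {u v : V} (h : G.HasWalk (n + 1) u v) :
    ∃ w, G.HasWalk n u w ∧ G.Adj w v := by
  induction n generalizing u with
  | zero => exact ⟨u, rfl, hasWalk_one.1 h⟩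
  | succ n ih =>
    obtain ⟨x, hx, hxv⟩ := h
    obtain ⟨w, hw, hwv⟩ := ih hxv
    exact ⟨w, ⟨x, hx, hw⟩, hwv⟩

/-- A set that is closed under out-neighbours contains everything reachable from it. -/
theorem HasWalk.mem_of_closed {n : ℕ} {u v : V} {s : Set V} (h : G.HasWalk n u v) (hu : u ∈ s)
    (hs : ∀ x ∈ s, ∀ y, G.Adj x y → y ∈ s) : v ∈ s := by
  induction n generalizing u with
  | zero => obtain rfl : u = v := h; exact hu
  | succ n ih =>
    obtain ⟨x, hx, hxv⟩ := h
    exact ih hxv (hs u hu x hx)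

theorem ddist_le {n : ℕ} {u v : V} (h : G.HasWalk n u v) : G.ddist u v ≤ n :=
  Nat.sInf_le h

@[simp] theorem ddist_self (u : V) : G.ddist u u = 0 :=
  Nat.le_zero.1 (ddist_le (n := 0) rfl)

namespace IsStronglyConnected

variable (h : G.IsStronglyConnected)
include h

theorem hasWalk_ddist (u v : V) : G.HasWalk (G.ddist u v) u v :=
  Nat.sInf_mem (h u v)

theorem ddist_triangle (u v w : V) : G.ddist u w ≤ G.ddist u v + G.ddist v w :=
  ddist_le ((h.hasWalk_ddist u v).trans (h.hasWalk_ddist v w))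

theorem ddist_eq_zero {u v : V} : G.ddist u v = 0 ↔ u = v := by
  refine ⟨fun h0 => ?_, fun e => e ▸ ddist_self u⟩
  have := h.hasWalk_ddist u v
  rw [h0] at this
  exact this

theorem ddist_le_succ (u : V) {v w : V} (hvw : G.Adj v w) : G.ddist u w ≤ G.ddist u v + 1 :=
  ddist_le ((h.hasWalk_ddist u v).trans (hasWalk_one.2 hvw))

theorem exists_first {n : ℕ} {u v : V} (huv : G.ddist u v = n + 1) :
    ∃ w, G.Adj u w ∧ G.ddist w v = n := by
  have hw := h.hasWalk_ddist u v
  rw [huv] at hw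
  obtain ⟨w, hw, hwv⟩ := hw
  refine ⟨w, hw, le_antisymm (ddist_le hwv) ?_⟩
  have h1 : G.ddist u v ≤ G.ddist w v + 1 := ddist_le ⟨w, hw, h.hasWalk_ddist w v⟩
  omega

theorem exists_last {n : ℕ} {u v : V} (huv : G.ddist u v = n + 1) :
    ∃ w, G.ddist u w = n ∧ G.Adj w v := by
  have hw := h.hasWalk_ddist u v
  rw [huv] at hw
  obtain ⟨w, hw, hwv⟩ := hw.exists_last
  refine ⟨w, le_antisymm (ddist_le hw) ?_, hwv⟩
  have h1 := h.ddist_le_succ u hwv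
  omega

theorem exists_ddist_eq_of_le {n : ℕ} {u v : V} (hn : n ≤ G.ddist u v) :
    ∃ w, G.ddist u w = n := by
  induction hk : G.ddist u v - n generalizing v with
  | zero => exact ⟨v, by omega⟩
  | succ k ih =>
    obtain ⟨w, hw, -⟩ := h.exists_last (n := n + k) (u := u) (v := v) (by omega)
    exact ih (v := w) (by omega) (by omega)

end IsStronglyConnected

namespace IsDistanceRegular

variable (hG : G.IsDistanceRegular)
include hG

theorem ddist_eq_one {u v : V} : G.ddist u v = 1 ↔ G.Adj u v := by
  constructor
  · intro h
    have := hG.stronglyConnected.hasWalk_ddist u v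
    rwa [h, hasWalk_one] at this
  · intro h
    have h1 := ddist_le (hasWalk_one.2 h)
    have h0 : G.ddist u v ≠ 0 := fun h0 => by
      rw [hG.stronglyConnected.ddist_eq_zero] at h0
      exact hG.loopless v (h0 ▸ h)
    omega

theorem ne_of_adj {u v : V} (h : G.Adj u v) : u ≠ v :=
  fun e => hG.loopless v (e ▸ h)

end IsDistanceRegular

/-- The finite set of out-neighbours of a vertex. -/
noncomputable def outNbrs [Fintype V] (G : Digraph V) (v : V) : Finset V :=
  Finset.univ.filter (G.Adj v)

/-- The finite set of in-neighbours of a vertex. -/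
noncomputable def inNbrs [Fintype V] (G : Digraph V) (v : V) : Finset V :=
  Finset.univ.filter (G.Adj · v)

@[simp] theorem mem_outNbrs [Fintype V] {u v : V} : v ∈ G.outNbrs u ↔ G.Adj u v := by
  simp [outNbrs]

@[simp] theorem mem_inNbrs [Fintype V] {u v : V} : u ∈ G.inNbrs v ↔ G.Adj u v := by
  simp [inNbrs]

namespace IsDistanceRegular

variable [Fintype V] (hG : G.IsDistanceRegular)
include hG

/-- The defining condition in `Finset` form; the bound `i ≤ l + 1` may be dropped, since beyond it
both sets are empty. -/
theorem card_filter_outNbrs_eq (i : ℕ) {u v u' v' : V} (h0 : G.ddist u v ≠ 0)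
    (h : G.ddist u v = G.ddist u' v') :
    ((G.outNbrs v).filter (fun w => G.ddist u w = i)).card =
      ((G.outNbrs v').filter (fun w => G.ddist u' w = i)).card := by
  have key : ∀ u v : V, ((G.outNbrs v).filter (fun w => G.ddist u w = i)).card =
      (G.outShell i u ∩ G.outShell 1 v).ncard := by
    intro u v
    rw [← Set.ncard_coe_finset]
    congr 1
    ext w
    simp [outShell, hG.ddist_eq_one, and_comm]
  have empty : ∀ u v : V, G.ddist u v + 1 < i →
      ((G.outNbrs v).filter (fun w => G.ddist u w = i)).card = 0 := by
    intro u v hi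
    rw [Finset.card_eq_zero, Finset.filter_eq_empty_iff]
    intro w hw
    have := hG.stronglyConnected.ddist_le_succ u (mem_outNbrs.1 hw)
    omega
  by_cases hi : i ≤ G.ddist u v + 1
  · rw [key, key]
    exact hG.card_inter_eq _ i (Nat.one_le_iff_ne_zero.2 h0) hi u v u' v' rfl h.symm
  · rw [empty u v (by omega), empty u' v' (by omega)]

/-- A sum over the out-neighbours `w` of `v` of a function of `ddist u w` depends only on
`ddist u v`, as long as `u ≠ v`. -/
theorem sum_outNbrs_eq {R : Type*} [Semiring R] (f : ℕ → R) {u v u' v' : V}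
    (h0 : G.ddist u v ≠ 0) (h : G.ddist u v = G.ddist u' v') :
    ∑ w ∈ G.outNbrs v, f (G.ddist u w) = ∑ w ∈ G.outNbrs v', f (G.ddist u' w) := by
  have key : ∀ u v : V, ∑ w ∈ G.outNbrs v, f (G.ddist u w) =
      ∑ i ∈ Finset.range (G.ddist u v + 2),
        ((G.outNbrs v).filter (fun w => G.ddist u w = i)).card * f i := by
    intro u v
    rw [← Finset.sum_fiberwise_of_maps_to (s := G.outNbrs v) (t := Finset.range (G.ddist u v + 2))
      (g := fun w => G.ddist u w)]
    · refine Finset.sum_congr rfl fun i _ => ?_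
      rw [Finset.sum_congr rfl (g := fun _ => f i), Finset.sum_const, nsmul_eq_mul]
      intro w hw
      rw [(Finset.mem_filter.1 hw).2]
    · intro w hw
      have := hG.stronglyConnected.ddist_le_succ u (mem_outNbrs.1 hw)
      simp only [Finset.mem_range]
      omega
  rw [key, key, h]
  refine Finset.sum_congr rfl fun i _ => ?_
  rw [hG.card_filter_outNbrs_eq i h0 h]

/-- The out-degree is constant: every vertex has an in-neighbour, so its out-degree is the sum of
the intersection numbers for pairs at distance one. -/
theorem card_outNbrs_eq [Nontrivial V] (v v' : V) :
    (G.outNbrs v).card = (G.outNbrs v').card := by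
  have key : ∀ v, ∃ u, G.ddist u v = 1 := by
    intro v
    obtain ⟨x, hx⟩ := exists_ne v
    have h0 : G.ddist x v ≠ 0 := fun h0 => hx (hG.stronglyConnected.ddist_eq_zero.1 h0)
    obtain ⟨n, hn⟩ := Nat.exists_eq_succ_of_ne_zero h0
    obtain ⟨w, -, hw⟩ := hG.stronglyConnected.exists_last hn
    exact ⟨w, hG.ddist_eq_one.2 hw⟩
  obtain ⟨u, hu⟩ := key v
  obtain ⟨u', hu'⟩ := key v'
  have := hG.sum_outNbrs_eq (fun _ => (1 : ℕ)) (u := u) (v := v) (u' := u') (v' := v')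
    (by omega) (by omega)
  simpa using this

end IsDistanceRegular

end Digraph

/-! ### Matrices whose entries depend on the distance -/

namespace Digraph

open scoped Classical
open Matrix

variable {V : Type*} {G : Digraph V}

/-- The matrices whose `(u, v)` entry depends only on the directed distance from `u` to `v`. -/
def distSpace (G : Digraph V) : Submodule ℚ (Matrix V V ℚ) where
  carrier := {X | ∀ u v u' v', G.ddist u v = G.ddist u' v' → X u v = X u' v'}
  add_mem' hX hY u v u' v' h := by
    simp only [Matrix.add_apply, hX u v u' v' h, hY u v u' v' h]
  zero_mem' _ _ _ _ _ := rfl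
  smul_mem' c X hX u v u' v' h := by
    simp only [Matrix.smul_apply, hX u v u' v' h]

/-- The matrix in `distSpace G` obtained from a function of the distance. -/
theorem of_ddist_mem_distSpace (f : ℕ → ℚ) :
    (Matrix.of fun u v => f (G.ddist u v)) ∈ G.distSpace := by
  intro u v u' v' h
  simp only [Matrix.of_apply, h]

/-- The transposed adjacency matrix. -/
noncomputable def revAdjMatrix (G : Digraph V) : Matrix V V ℚ :=
  Matrix.of fun u v => if G.Adj v u then 1 else 0

section Fintype

variable [Fintype V]

theorem mul_revAdjMatrix_apply (X : Matrix V V ℚ) (u v : V) :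
    (X * G.revAdjMatrix) u v = ∑ w ∈ G.outNbrs v, X u w := by
  simp [Matrix.mul_apply, revAdjMatrix, outNbrs, Finset.sum_filter]

/-- Powers of the transposed adjacency matrix are positive exactly where there is a walk. -/
theorem revAdjMatrix_pow_apply (n : ℕ) (u v : V) :
    0 ≤ (G.revAdjMatrix ^ n) u v ∧ ((G.revAdjMatrix ^ n) u v ≠ 0 ↔ G.HasWalk n v u) := by
  induction n generalizing v with
  | zero =>
    simp only [pow_zero, Matrix.one_apply, HasWalk]
    split_ifs with h
    · simp [h]
    · simp [Ne.symm h]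
  | succ n ih =>
    rw [pow_succ, mul_revAdjMatrix_apply]
    refine ⟨Finset.sum_nonneg fun w _ => (ih w).1, ?_⟩
    rw [Ne, Finset.sum_eq_zero_iff_of_nonneg fun w _ => (ih w).1]
    push Not
    simp only [mem_outNbrs, (ih _).2, HasWalk]

end Fintype

namespace IsDistanceRegular

variable (hG : G.IsDistanceRegular)
include hG

theorem one_mem_distSpace : (1 : Matrix V V ℚ) ∈ G.distSpace := by
  intro u v u' v' h
  simp only [Matrix.one_apply, ← hG.stronglyConnected.ddist_eq_zero, h]

theorem adjMatrix_mem_distSpace :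
    (Matrix.of fun u v => if G.Adj u v then (1 : ℚ) else 0) ∈ G.distSpace := by
  intro u v u' v' h
  simp only [Matrix.of_apply, ← hG.ddist_eq_one, h]

end IsDistanceRegular

namespace IsDistanceRegular

variable [Fintype V] [Nontrivial V] (hG : G.IsDistanceRegular)
include hG

/-- This is where the hypothesis of distance-regularity enters: the counts in its definition are the
entries of products with the transposed adjacency matrix. -/
theorem mul_revAdjMatrix_mem {X : Matrix V V ℚ} (hX : X ∈ G.distSpace) :
    X * G.revAdjMatrix ∈ G.distSpace := by
  obtain ⟨f, hf⟩ : ∃ f : ℕ → ℚ, ∀ u v, X u v = f (G.ddist u v) := by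
    refine ⟨fun i => if h : ∃ p : V × V, G.ddist p.1 p.2 = i then X h.choose.1 h.choose.2 else 0,
      fun u v => ?_⟩
    have h : ∃ p : V × V, G.ddist p.1 p.2 = G.ddist u v := ⟨(u, v), rfl⟩
    simp only [dif_pos h]
    exact hX _ _ _ _ h.choose_spec.symm
  intro u v u' v' h
  rw [mul_revAdjMatrix_apply, mul_revAdjMatrix_apply]
  simp only [hf]
  by_cases h0 : G.ddist u v = 0
  · have h0' : G.ddist u' v' = 0 := h ▸ h0
    rw [hG.stronglyConnected.ddist_eq_zero] at h0 h0'
    subst h0 h0'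
    have key : ∀ u, ∑ w ∈ G.outNbrs u, f (G.ddist u w) = (G.outNbrs u).card * f 1 := by
      intro u
      rw [Finset.sum_congr rfl (g := fun _ => f 1), Finset.sum_const, nsmul_eq_mul]
      intro w hw
      rw [hG.ddist_eq_one.2 (mem_outNbrs.1 hw)]
    rw [key, key, hG.card_outNbrs_eq u u']
  · exact hG.sum_outNbrs_eq f h0 h

theorem revAdjMatrix_pow_mem (n : ℕ) : G.revAdjMatrix ^ n ∈ G.distSpace := by
  induction n with
  | zero => rw [pow_zero]; exact hG.one_mem_distSpace
  | succ n ih => rw [pow_succ]; exact hG.mul_revAdjMatrix_mem ih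

theorem aeval_revAdjMatrix_mem (p : Polynomial ℚ) :
    Polynomial.aeval G.revAdjMatrix p ∈ G.distSpace := by
  rw [Polynomial.aeval_eq_sum_range]
  exact Submodule.sum_mem _ fun i _ => Submodule.smul_mem _ _ (hG.revAdjMatrix_pow_mem i)

/-- Every matrix whose entries depend only on the distance is a polynomial in the transposed
adjacency matrix `M`. If `d` is the largest distance, then `1, M, …, M ^ d` are linearly
independent, because `M ^ j` is the first power that does not vanish at `(u, v)` when the distance
from `v` to `u` is `j`; and `distSpace G` has dimension at most `d + 1`. -/
theorem exists_aeval_eq {X : Matrix V V ℚ} (hX : X ∈ G.distSpace) :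
    ∃ p : Polynomial ℚ, Polynomial.aeval G.revAdjMatrix p = X := by
  obtain ⟨⟨a, z⟩, -, hmax⟩ := Finset.exists_max_image (Finset.univ : Finset (V × V))
    (fun p => G.ddist p.1 p.2) Finset.univ_nonempty
  set d := G.ddist a z
  have hle : ∀ u v, G.ddist u v ≤ d := fun u v => hmax (u, v) (Finset.mem_univ _)
  have hex : ∀ i : Fin (d + 1), ∃ y, G.ddist a y = i := fun i =>
    hG.stronglyConnected.exists_ddist_eq_of_le (Nat.lt_succ_iff.1 i.2)
  choose y hy using hex
  -- A matrix in `distSpace G` is determined by its entries at the pairs `(a, y i)`.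
  have hdet : ∀ Y ∈ G.distSpace, (∀ i, Y a (y i) = 0) → Y = 0 := by
    intro Y hY h
    ext u v
    have := hY u v a (y ⟨G.ddist u v, Nat.lt_succ_iff.2 (hle u v)⟩) (by rw [hy])
    rw [this, h]
    rfl
  let P : (Fin (d + 1) → ℚ) →ₗ[ℚ] Matrix V V ℚ :=
    Fintype.linearCombination ℚ (fun j : Fin (d + 1) => G.revAdjMatrix ^ (j : ℕ))
  have hP : ∀ c, P c = ∑ j, c j • G.revAdjMatrix ^ (j : ℕ) := fun c =>
    Fintype.linearCombination_apply ℚ _ c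
  have hPmem : ∀ c, P c ∈ G.distSpace := fun c => by
    rw [hP]
    exact Submodule.sum_mem _ fun i _ => Submodule.smul_mem _ _ (hG.revAdjMatrix_pow_mem i)
  let E : Matrix V V ℚ →ₗ[ℚ] (Fin (d + 1) → ℚ) :=
    LinearMap.pi fun i => Matrix.entryLinearMap ℚ ℚ a (y i)
  have hE : ∀ Y i, E Y i = Y a (y i) := fun Y i => rfl
  have hinj : Function.Injective (E ∘ₗ P) := by
    rw [← LinearMap.ker_eq_bot, LinearMap.ker_eq_bot']
    intro c hc
    have h0 : P c = 0 := hdet _ (hPmem c) fun i => congrFun hc i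
    by_contra hne
    obtain ⟨j, hj⟩ := Function.ne_iff.1 hne
    obtain ⟨m, hm, hmmax⟩ := Finset.exists_max_image
      (Finset.univ.filter fun j => c j ≠ 0) (fun j : Fin (d + 1) => (j : ℕ)) ⟨j, by simpa using hj⟩
    have hcm : c m ≠ 0 := by simpa using hm
    have hentry : P c (y m) a = c m * (G.revAdjMatrix ^ (m : ℕ)) (y m) a := by
      rw [hP, Matrix.sum_apply, Finset.sum_eq_single m]
      · rfl
      · intro i _ hi
        rw [Matrix.smul_apply, smul_eq_mul]
        by_cases hci : c i = 0
        · rw [hci, zero_mul]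
        · have him : (i : ℕ) ≤ m := hmmax i (by simpa using hci)
          have hlt : (i : ℕ) < m := lt_of_le_of_ne him (fun e => hi (Fin.ext e))
          have : (G.revAdjMatrix ^ (i : ℕ)) (y m) a = 0 := by
            by_contra hnz
            have := ddist_le ((revAdjMatrix_pow_apply _ _ _).2.1 hnz)
            rw [hy] at this
            omega
          rw [this, mul_zero]
      · simp
    rw [h0, Matrix.zero_apply, eq_comm, mul_eq_zero] at hentry
    refine hentry.elim hcm ((revAdjMatrix_pow_apply _ _ _).2.2 ?_)
    have := hG.stronglyConnected.hasWalk_ddist a (y m)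
    rwa [hy] at this
  obtain ⟨c, hc⟩ := (LinearMap.injective_iff_surjective.1 hinj) (E X)
  refine ⟨∑ j : Fin (d + 1), Polynomial.monomial (j : ℕ) (c j), ?_⟩
  have : P c - X = 0 := hdet _ (Submodule.sub_mem _ (hPmem c) hX) fun i => by
    have := congrFun hc i
    rw [LinearMap.comp_apply, hE, hE] at this
    rw [Matrix.sub_apply, this, sub_self]
  rw [← sub_eq_zero.1 this, hP, map_sum]
  refine Finset.sum_congr rfl fun j _ => ?_
  rw [Polynomial.aeval_monomial, Algebra.smul_def]

theorem mul_mem_distSpace {X Y : Matrix V V ℚ} (hX : X ∈ G.distSpace) (hY : Y ∈ G.distSpace) :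
    X * Y ∈ G.distSpace := by
  obtain ⟨p, rfl⟩ := hG.exists_aeval_eq hX
  obtain ⟨q, rfl⟩ := hG.exists_aeval_eq hY
  rw [← map_mul]
  exact hG.aeval_revAdjMatrix_mem _

theorem mul_comm_of_mem_distSpace {X Y : Matrix V V ℚ} (hX : X ∈ G.distSpace)
    (hY : Y ∈ G.distSpace) : X * Y = Y * X := by
  obtain ⟨p, rfl⟩ := hG.exists_aeval_eq hX
  obtain ⟨q, rfl⟩ := hG.exists_aeval_eq hY
  rw [← map_mul, ← map_mul, mul_comm]

/-- In-degrees and out-degrees agree: they are the diagonal entries of the two products of the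
adjacency matrix and its transpose, which commute. -/
theorem card_inNbrs_eq (v : V) : (G.inNbrs v).card = (G.outNbrs v).card := by
  have hA := hG.adjMatrix_mem_distSpace
  have hM : G.revAdjMatrix ∈ G.distSpace := by simpa using hG.revAdjMatrix_pow_mem 1
  have h := congrFun (congrFun (hG.mul_comm_of_mem_distSpace hM hA) v) v
  simp only [Matrix.mul_apply, revAdjMatrix, Matrix.of_apply, ← ite_and, mul_ite, mul_one, mul_zero,
    and_self] at h
  simp only [Finset.sum_boole] at h
  exact_mod_cast h

/-- The number of in-neighbours `w` of `v` with `ddist u w = i` depends only on `ddist u v`. -/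
theorem card_filter_inNbrs_eq (i : ℕ) {u v u' v' : V} (h : G.ddist u v = G.ddist u' v') :
    ((G.inNbrs v).filter (fun w => G.ddist u w = i)).card =
      ((G.inNbrs v').filter (fun w => G.ddist u' w = i)).card := by
  have hA := hG.adjMatrix_mem_distSpace
  have key : ∀ u v, (((G.inNbrs v).filter (fun w => G.ddist u w = i)).card : ℚ) =
      ((Matrix.of fun u v => (fun j => if j = i then (1 : ℚ) else 0) (G.ddist u v)) *
        (Matrix.of fun u v => if G.Adj u v then (1 : ℚ) else 0)) u v := by
    intro u v
    simp only [Matrix.mul_apply, Matrix.of_apply, mul_ite, mul_one, mul_zero, ← ite_and,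
      Finset.sum_boole, inNbrs, Finset.filter_filter]
  have := hG.mul_mem_distSpace (of_ddist_mem_distSpace fun j => if j = i then (1 : ℚ) else 0) hA
    u v u' v' h
  rw [← key, ← key] at this
  exact_mod_cast this

end IsDistanceRegular

end Digraph

/-! ### Intersection numbers and the expansion bound -/

/-- Weights solving `c i * w i = 1 + b i * w (i + 1)` backwards from `w (d + 1) = 0` decrease,
because `b` decreases and `c` increases. -/
theorem exists_antitone_weights (b c : ℕ → ℚ) (d : ℕ) (hb0 : ∀ i, 0 ≤ b i)
    (hb : ∀ i, 1 ≤ i → i < d → b (i + 1) ≤ b i) (hc : ∀ i, 1 ≤ i → i < d → c i ≤ c (i + 1))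
    (hc0 : ∀ i, 1 ≤ i → i ≤ d → 0 < c i) :
    ∃ w : ℕ → ℚ, (∀ i, 1 ≤ i → 0 ≤ w i) ∧ w (d + 1) = 0 ∧ (∀ i, 1 ≤ i → i ≤ d → w (i + 1) ≤ w i) ∧
      ∀ i, 1 ≤ i → i ≤ d → c i * w i = 1 + b i * w (i + 1) := by
  let v : ℕ → ℚ := fun n => Nat.rec 0 (fun n x => (1 + b (d - n) * x) / c (d - n)) n
  have hv0 : v 0 = 0 := rfl
  have hv : ∀ n, v (n + 1) = (1 + b (d - n) * v n) / c (d - n) := fun n => rfl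
  have hnn : ∀ n, n ≤ d → 0 ≤ v n := by
    intro n
    induction n with
    | zero => intro _; exact hv0.ge
    | succ n ih =>
      intro hn
      rw [hv]
      exact div_nonneg (add_nonneg zero_le_one (mul_nonneg (hb0 _) (ih (by omega))))
        (hc0 _ (by omega) (by omega)).le
  have hmono : ∀ n, n + 1 ≤ d → v n ≤ v (n + 1) := by
    intro n
    induction n with
    | zero => intro hn; rw [hv0]; exact hnn _ hn
    | succ n ih =>
      intro hn
      have e : d - n = d - (n + 1) + 1 := by omega
      rw [hv (n + 1)]
      conv_lhs => rw [hv n]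
      have hc1 := hc (d - (n + 1)) (by omega) (by omega)
      have hb1 := hb (d - (n + 1)) (by omega) (by omega)
      rw [← e] at hc1 hb1
      refine div_le_div₀ ?_ ?_ (hc0 _ (by omega) (by omega)) hc1
      · exact add_nonneg zero_le_one (mul_nonneg (hb0 _) (hnn (n + 1) (by omega)))
      · have h1 := mul_le_mul hb1 (ih (by omega)) (hnn _ (by omega)) (hb0 _)
        linarith
  refine ⟨fun i => v (d + 1 - i), fun i hi => hnn _ (by omega), by simp [hv0], fun i h1 hi => ?_,
    fun i h1 hi => ?_⟩
  · have := hmono (d - i) (by omega)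
    rwa [show d - i + 1 = d + 1 - i by omega, show d - i = d + 1 - (i + 1) by omega] at this
  · have e : d + 1 - i = (d - i) + 1 := by omega
    have e' : d + 1 - (i + 1) = d - i := by omega
    have e'' : d - (d - i) = i := by omega
    have := (hc0 i h1 hi).ne'
    simp only [e, e', hv, e'']
    field_simp

/-- The numerical core of the expansion bound. Here `κ i` is the size of the `i`-th layer, `β i` the
size of a part of it that is empty for `i = 1`, and `t i` bounds the number of edges that enter this
part from the rest of the previous layer. -/
theorem sum_layers_mul_le (b c κ β t : ℕ → ℚ) (m : ℕ) (hb0 : ∀ i, 0 ≤ b i)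
    (hb : ∀ i, 1 ≤ i → i < m + 1 → b (i + 1) ≤ b i)
    (hc : ∀ i, 1 ≤ i → i < m + 1 → c i ≤ c (i + 1))
    (hc0 : ∀ i, 1 ≤ i → i ≤ m + 1 → 0 < c i)
    (hκ : ∀ i, 1 ≤ i → i < m + 1 → c (i + 1) * κ (i + 1) = b i * κ i)
    (hβ : ∀ i, 1 ≤ i → i < m + 1 → c (i + 1) * β (i + 1) ≤ b i * β i + t (i + 1))
    (ht : ∀ i, 0 ≤ t i) (hκ1 : 0 ≤ κ 1) (hβ1 : β 1 = 0) :
    (∑ j ∈ Finset.range m, β (j + 2)) * (b 1 * κ 1) ≤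
      (∑ j ∈ Finset.range m, t (j + 2)) * ∑ j ∈ Finset.range m, κ (j + 2) := by
  obtain ⟨w, hw0, hwd, hw, hwe⟩ := exists_antitone_weights b c (m + 1) hb0 hb hc hc0
  have hw2 : ∀ j, j ≤ m → w (j + 2) ≤ w 2 := by
    intro j
    induction j with
    | zero => intro _; exact le_rfl
    | succ j ih =>
      intro hj
      exact (hw (j + 2) (by omega) (by omega)).trans (ih (by omega))
  have h1 : ∀ l, l ≤ m → (∑ j ∈ Finset.range l, β (j + 2)) + b (l + 1) * β (l + 1) * w (l + 2) ≤
      w 2 * ∑ j ∈ Finset.range l, t (j + 2) := by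
    intro l
    induction l with
    | zero => intro _; simp [hβ1]
    | succ l ih =>
      intro hl
      rw [Finset.sum_range_succ, Finset.sum_range_succ, mul_add]
      have e1 := hwe (l + 2) (by omega) (by omega)
      have e2 := hβ (l + 1) (by omega) (by omega)
      have e3 := mul_le_mul_of_nonneg_right e2 (hw0 (l + 2) (by omega))
      have e4 := mul_le_mul_of_nonneg_right (hw2 l (by omega)) (ht (l + 2))
      have e5 := ih (by omega)
      have e6 : β (l + 2) + b (l + 2) * β (l + 2) * w (l + 3) =
          c (l + 2) * β (l + 2) * w (l + 2) := by
        linear_combination (-β (l + 2)) * e1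
      simp only [add_assoc, Nat.reduceAdd] at *
      linarith
  have h2 : ∀ l, l ≤ m → (∑ j ∈ Finset.range l, κ (j + 2)) + b (l + 1) * κ (l + 1) * w (l + 2) =
      w 2 * (b 1 * κ 1) := by
    intro l
    induction l with
    | zero => intro _; simp [mul_comm]
    | succ l ih =>
      intro hl
      rw [Finset.sum_range_succ, ← ih (by omega)]
      have e1 := hwe (l + 2) (by omega) (by omega)
      have e2 := hκ (l + 1) (by omega) (by omega)
      simp only [add_assoc, Nat.reduceAdd] at *
      linear_combination (-κ (l + 2)) * e1 + w (l + 2) * e2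
  have h1m := h1 m le_rfl
  have h2m := h2 m le_rfl
  rw [show m + 2 = m + 1 + 1 by omega, hwd, mul_zero, add_zero] at h1m h2m
  rw [h2m]
  have := mul_le_mul_of_nonneg_right h1m (mul_nonneg (hb0 1) hκ1)
  linarith

theorem Finset.sup_eq_of_forall_eq {α : Type*} (s : Finset α) (f : α → ℕ) {a : α} (ha : a ∈ s)
    (h : ∀ x ∈ s, f x = f a) : s.sup f = f a :=
  le_antisymm (Finset.sup_le fun x hx => (h x hx).le) (Finset.le_sup ha)

theorem Finset.sum_range_sum_filter_eq {α : Type*} (s : Finset α) (f : α → ℕ) (g : α → ℕ)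
    (m r : ℕ) :
    ∑ j ∈ Finset.range m, ∑ x ∈ s.filter (fun x => f x = j + r), g x =
      ∑ x ∈ s.filter (fun x => r ≤ f x ∧ f x < m + r), g x := by
  rw [← Finset.sum_fiberwise_of_maps_to (t := Finset.range m) (g := fun x => f x - r)]
  · refine Finset.sum_congr rfl fun j hj => Finset.sum_congr ?_ fun _ _ => rfl
    ext x
    simp only [Finset.mem_filter, Finset.mem_range] at hj ⊢
    constructor
    · rintro ⟨hx, h⟩; exact ⟨⟨hx, by omega, by omega⟩, by omega⟩
    · rintro ⟨⟨hx, h, -⟩, h'⟩; exact ⟨hx, by omega⟩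
  · intro x hx
    simp only [Finset.mem_filter, Finset.mem_range] at hx ⊢
    omega

namespace Digraph

open scoped Classical

variable {V : Type*} [Fintype V] {G : Digraph V}

/-- The intersection number `b i`: the number of out-neighbours of `v` that are at distance `i + 1`
from `u`, when `v` is at distance `i` from `u`. It is encoded as a maximum over all such pairs, so
it is `0` if there are none. -/
noncomputable def forwardNum (G : Digraph V) (i : ℕ) : ℕ :=
  (Finset.univ.filter fun p : V × V => G.ddist p.1 p.2 = i).sup fun p =>
    ((G.outNbrs p.2).filter fun w => G.ddist p.1 w = i + 1).card

/-- The intersection number `c i`: the number of in-neighbours of `v` that are at distance `i - 1`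
from `u`, when `v` is at distance `i` from `u`. It is encoded as a maximum over all such pairs, so
it is `0` if there are none. The subtraction is truncated, and only `i ≥ 1` is meaningful. -/
noncomputable def backwardNum (G : Digraph V) (i : ℕ) : ℕ :=
  (Finset.univ.filter fun p : V × V => G.ddist p.1 p.2 = i).sup fun p =>
    ((G.inNbrs p.2).filter fun w => G.ddist p.1 w = i - 1).card

/-- The number of edges from `A` to its complement. -/
noncomputable def cutSize (G : Digraph V) (A : Finset V) : ℕ :=
  ∑ x ∈ A, (G.outNbrs x \ A).card

namespace IsDistanceRegular

theorem card_forward (hG : G.IsDistanceRegular) {i : ℕ} (hi : i ≠ 0) {u v : V}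
    (h : G.ddist u v = i) :
    ((G.outNbrs v).filter fun w => G.ddist u w = i + 1).card = G.forwardNum i := by
  refine (Finset.sup_eq_of_forall_eq _ (fun p : V × V => ((G.outNbrs p.2).filter
    fun w => G.ddist p.1 w = i + 1).card) (a := (u, v)) (by simpa using h) ?_).symm
  rintro ⟨u', v'⟩ h'
  simp only [Finset.mem_filter, Finset.mem_univ, true_and] at h'
  exact hG.card_filter_outNbrs_eq _ (h' ▸ hi) (h'.trans h.symm)

theorem forwardNum_succ_le (hG : G.IsDistanceRegular) {i : ℕ} (hi : i ≠ 0) {u v : V}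
    (h : G.ddist u v = i + 1) :
    G.forwardNum (i + 1) ≤ G.forwardNum i := by
  obtain ⟨x, hux, hx⟩ := hG.stronglyConnected.exists_first h
  rw [← hG.card_forward (by omega) h, ← hG.card_forward hi hx]
  refine Finset.card_le_card fun w hw => ?_
  rw [Finset.mem_filter] at hw ⊢
  refine ⟨hw.1, ?_⟩
  have h1 := hG.stronglyConnected.ddist_triangle u x w
  have h2 := hG.stronglyConnected.ddist_le_succ x (mem_outNbrs.1 hw.1)
  rw [hG.ddist_eq_one.2 hux] at h1
  omega

variable [Nontrivial V] (hG : G.IsDistanceRegular)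
include hG

theorem card_backward {i : ℕ} {u v : V} (h : G.ddist u v = i) :
    ((G.inNbrs v).filter fun w => G.ddist u w = i - 1).card = G.backwardNum i := by
  refine (Finset.sup_eq_of_forall_eq _ (fun p : V × V => ((G.inNbrs p.2).filter
    fun w => G.ddist p.1 w = i - 1).card) (a := (u, v)) (by simpa using h) ?_).symm
  rintro ⟨u', v'⟩ h'
  simp only [Finset.mem_filter, Finset.mem_univ, true_and] at h'
  exact hG.card_filter_inNbrs_eq _ (h'.trans h.symm)

theorem backwardNum_le_succ {i : ℕ} {u v : V} (hi : i ≠ 0) (h : G.ddist u v = i + 1) :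
    G.backwardNum i ≤ G.backwardNum (i + 1) := by
  obtain ⟨x, hux, hx⟩ := hG.stronglyConnected.exists_first h
  rw [← hG.card_backward h, ← hG.card_backward hx]
  refine Finset.card_le_card fun w hw => ?_
  rw [Finset.mem_filter] at hw ⊢
  refine ⟨hw.1, ?_⟩
  have h1 := hG.stronglyConnected.ddist_triangle u x w
  have h2 := hG.stronglyConnected.ddist_le_succ u (mem_inNbrs.1 hw.1)
  rw [hG.ddist_eq_one.2 hux] at h1
  omega

theorem backwardNum_pos {i : ℕ} {u v : V} (hi : i ≠ 0) (h : G.ddist u v = i) :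
    0 < G.backwardNum i := by
  obtain ⟨n, rfl⟩ := Nat.exists_eq_succ_of_ne_zero hi
  obtain ⟨x, hx, hxv⟩ := hG.stronglyConnected.exists_last h
  rw [← hG.card_backward h, Finset.card_pos]
  exact ⟨x, by simp [hxv, hx]⟩

/-- Counting the edges from the `i`-th layer around `a` into a part `T` of the next layer. -/
theorem backwardNum_mul_card (a : V) (i : ℕ) (T : Finset V) :
    G.backwardNum (i + 1) * (T.filter fun y => G.ddist a y = i + 1).card =
      ∑ x ∈ Finset.univ.filter (fun x => G.ddist a x = i),
        ((G.outNbrs x ∩ T).filter fun y => G.ddist a y = i + 1).card := by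
  have h := Finset.sum_card_bipartiteAbove_eq_sum_card_bipartiteBelow G.Adj
    (s := Finset.univ.filter fun x => G.ddist a x = i) (t := T.filter fun y => G.ddist a y = i + 1)
  rw [mul_comm, ← smul_eq_mul, ← Finset.sum_const]
  refine ((Finset.sum_congr rfl fun x _ => ?_).trans (h.trans
    (Finset.sum_congr rfl fun y hy => ?_))).symm
  · congr 1
    ext y
    simp only [Finset.mem_filter, Finset.mem_inter, mem_outNbrs, Finset.bipartiteAbove]
    tauto
  · rw [← hG.card_backward (Finset.mem_filter.1 hy).2]
    congr 1
    ext x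
    simp only [Finset.mem_filter, Finset.mem_univ, mem_inNbrs, Finset.bipartiteBelow,
      Nat.add_sub_cancel]
    tauto

/-- The expansion bound: if all out-neighbours of some `a ∈ A` lie in `A`, then many edges leave
`A`. With `β i` the number of vertices outside `A` in the `i`-th layer around `a`, counting edges
between consecutive layers bounds `c (i + 1) * β (i + 1)` by `b i * β i` plus the number of edges
that leave `A` between these layers. -/
theorem card_compl_mul_le {k : ℕ} (hk : ∀ v, (G.outNbrs v).card = k) {A : Finset V} {a : V}
    (ha : a ∈ A) (hNa : G.outNbrs a ⊆ A) :
    Aᶜ.card * (G.forwardNum 1 * k) + G.cutSize A * (k + 1) ≤ G.cutSize A * Fintype.card V := by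
  obtain ⟨⟨p, q⟩, -, hmax⟩ := Finset.exists_max_image (Finset.univ : Finset (V × V))
    (fun p => G.ddist p.1 p.2) Finset.univ_nonempty
  have hle : ∀ u v, G.ddist u v ≤ G.ddist p q := fun u v => hmax (u, v) (Finset.mem_univ _)
  obtain ⟨m, hm⟩ : ∃ m, G.ddist p q = m + 1 := by
    refine Nat.exists_eq_succ_of_ne_zero fun h0 => ?_
    obtain ⟨x, y, hxy⟩ := exists_pair_ne V
    exact hxy (hG.stronglyConnected.ddist_eq_zero.1 (Nat.le_zero.1 (h0 ▸ hle x y)))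
  have hex : ∀ i, i ≤ m + 1 → ∃ y, G.ddist p y = i := fun i hi =>
    hG.stronglyConnected.exists_ddist_eq_of_le (hm ▸ hi)
  let κ : ℕ → ℕ := fun i => (Finset.univ.filter fun y => G.ddist a y = i).card
  let β : ℕ → ℕ := fun i => (Aᶜ.filter fun y => G.ddist a y = i).card
  let g : V → ℕ := fun x => ((G.outNbrs x ∩ Aᶜ).filter fun y => G.ddist a y = G.ddist a x + 1).card
  let t : ℕ → ℕ := fun i => ∑ x ∈ A.filter (fun x => G.ddist a x = i - 1), g x
  have hκ1 : κ 1 = k := by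
    rw [← hk a]
    simp only [κ, hG.ddist_eq_one, outNbrs]
  have hnot : ∀ y ∈ Aᶜ, 2 ≤ G.ddist a y := by
    intro y hy
    rw [Finset.mem_compl] at hy
    by_contra hlt
    have : G.ddist a y = 0 ∨ G.ddist a y = 1 := by omega
    rcases this with h | h
    · exact hy (hG.stronglyConnected.ddist_eq_zero.1 h ▸ ha)
    · exact hy (hNa (mem_outNbrs.2 (hG.ddist_eq_one.1 h)))
  have hβ1 : β 1 = 0 := by
    rw [Finset.card_eq_zero, Finset.filter_eq_empty_iff]
    intro y hy
    have := hnot y hy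
    omega
  have hκ : ∀ i, 1 ≤ i → i < m + 1 → G.backwardNum (i + 1) * κ (i + 1) = G.forwardNum i * κ i := by
    intro i hi him
    rw [hG.backwardNum_mul_card a i Finset.univ, mul_comm, ← smul_eq_mul, ← Finset.sum_const]
    refine Finset.sum_congr rfl fun x hx => ?_
    rw [Finset.inter_univ, hG.card_forward (by omega) (Finset.mem_filter.1 hx).2]
  have hβ : ∀ i, 1 ≤ i → i < m + 1 →
      G.backwardNum (i + 1) * β (i + 1) ≤ G.forwardNum i * β i + t (i + 1) := by
    intro i hi him
    rw [hG.backwardNum_mul_card a i Aᶜ,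
      ← Finset.sum_filter_add_sum_filter_not _ (fun x => x ∈ Aᶜ)]
    refine add_le_add ?_ (le_of_eq ?_)
    · rw [mul_comm, ← smul_eq_mul, ← Finset.sum_const]
      have e : (Finset.univ.filter fun x => G.ddist a x = i).filter (fun x => x ∈ Aᶜ) =
          Aᶜ.filter fun y => G.ddist a y = i := by
        ext x
        simp [and_comm]
      rw [e]
      refine Finset.sum_le_sum fun x hx => ?_
      rw [← hG.card_forward (by omega) (Finset.mem_filter.1 hx).2]
      exact Finset.card_le_card (Finset.filter_subset_filter _ Finset.inter_subset_left)
    · have e : (Finset.univ.filter fun x => G.ddist a x = i).filter (fun x => x ∉ Aᶜ) =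
          A.filter fun y => G.ddist a y = i + 1 - 1 := by
        ext x
        simp [and_comm]
      rw [e]
      refine Finset.sum_congr rfl fun x hx => ?_
      have := (Finset.mem_filter.1 hx).2
      rw [Nat.add_sub_cancel] at this
      simp only [g, this]
  have hsumβ : ∑ j ∈ Finset.range m, β (j + 2) = Aᶜ.card := by
    simp only [β, Finset.card_eq_sum_ones]
    rw [Finset.sum_range_sum_filter_eq Aᶜ (G.ddist a) (fun _ => 1) m 2, Finset.filter_true_of_mem]
    intro y hy
    have := hnot y hy
    have := hle a y
    omega
  have hsumt : ∑ j ∈ Finset.range m, t (j + 2) ≤ G.cutSize A := by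
    simp only [t, show ∀ j, j + 2 - 1 = j + 1 from fun _ => rfl]
    rw [Finset.sum_range_sum_filter_eq A (G.ddist a) g m 1]
    refine (Finset.sum_le_sum_of_subset (Finset.filter_subset _ _)).trans
      (Finset.sum_le_sum fun x _ => Finset.card_le_card ?_)
    intro y hy
    simp only [Finset.mem_filter, Finset.mem_inter, Finset.mem_compl] at hy
    exact Finset.mem_sdiff.2 hy.1
  have hsumκ : (∑ j ∈ Finset.range m, κ (j + 2)) + (k + 1) = Fintype.card V := by
    simp only [κ, Finset.card_eq_sum_ones]
    rw [Finset.sum_range_sum_filter_eq Finset.univ (G.ddist a) (fun _ => 1) m 2,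
      ← Finset.card_eq_sum_ones, ← Finset.card_univ,
      ← Finset.card_filter_add_card_filter_not (s := Finset.univ)
        (fun x => 2 ≤ G.ddist a x ∧ G.ddist a x < m + 2)]
    congr 1
    rw [← hk a, ← Finset.card_insert_of_notMem (a := a) (by simpa using hG.loopless a)]
    congr 1
    ext y
    have := hle a y
    simp only [Finset.mem_insert, mem_outNbrs, Finset.mem_filter, Finset.mem_univ, true_and]
    rw [← hG.ddist_eq_one, eq_comm, ← hG.stronglyConnected.ddist_eq_zero]
    omega
  have main := sum_layers_mul_le (fun i => G.forwardNum i) (fun i => G.backwardNum i)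
    (fun i => κ i) (fun i => β i) (fun i => t i) m (fun i => Nat.cast_nonneg _)
    (fun i hi him => by
      obtain ⟨y, hy⟩ := hex (i + 1) (by omega)
      exact_mod_cast hG.forwardNum_succ_le (by omega) hy)
    (fun i hi him => by
      obtain ⟨y, hy⟩ := hex (i + 1) (by omega)
      exact_mod_cast hG.backwardNum_le_succ (by omega) hy)
    (fun i hi him => by
      obtain ⟨y, hy⟩ := hex i him
      exact_mod_cast hG.backwardNum_pos (by omega) hy)
    (fun i hi him => by exact_mod_cast hκ i hi him)
    (fun i hi him => by exact_mod_cast hβ i hi him)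
    (fun i => Nat.cast_nonneg _) (Nat.cast_nonneg _) (by exact_mod_cast hβ1)
  have main' : Aᶜ.card * (G.forwardNum 1 * k) ≤
      (∑ j ∈ Finset.range m, t (j + 2)) * ∑ j ∈ Finset.range m, κ (j + 2) := by
    rw [← hκ1, ← hsumβ]
    exact_mod_cast main
  rw [← hsumκ, mul_add (G.cutSize A) _ (k + 1)]
  exact Nat.add_le_add_right (main'.trans (Nat.mul_le_mul_right _ hsumt)) _

end IsDistanceRegular

end Digraph

/-! ### Small cuts -/

namespace Digraph

open scoped Classical

variable {V : Type*} [Fintype V] {G : Digraph V}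

theorem IsStronglyConnected.eq_univ_of_closed (h : G.IsStronglyConnected) {s : Finset V} {u : V}
    (hu : u ∈ s) (hs : ∀ x ∈ s, G.outNbrs x ⊆ s) : s = Finset.univ := by
  refine Finset.eq_univ_of_forall fun v => ?_
  obtain ⟨n, hn⟩ := h u v
  exact hn.mem_of_closed (s := (s : Set V)) hu fun x hx y hxy => hs x hx (mem_outNbrs.2 hxy)

/-- In a digraph whose in-degrees and out-degrees agree, a cut contains equally many edges in both
directions. -/
theorem cutSize_compl (h : ∀ v, (G.inNbrs v).card = (G.outNbrs v).card) (A : Finset V) :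
    G.cutSize Aᶜ = G.cutSize A := by
  have h1 : ∀ s t : Finset V,
      ∑ x ∈ s, (G.outNbrs x ∩ t).card = ∑ y ∈ t, (G.inNbrs y ∩ s).card := by
    intro s t
    have := Finset.sum_card_bipartiteAbove_eq_sum_card_bipartiteBelow G.Adj (s := s) (t := t)
    convert this using 3
    · ext y
      simp [Finset.bipartiteAbove, and_comm]
    · ext y
      simp [Finset.bipartiteBelow, and_comm]
  have h2 : G.cutSize Aᶜ = ∑ y ∈ A, (G.inNbrs y ∩ Aᶜ).card := by
    rw [← h1, cutSize]
    refine Finset.sum_congr rfl fun x _ => ?_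
    rw [Finset.sdiff_eq_inter_compl, compl_compl]
  have h3 : G.cutSize A + ∑ x ∈ A, (G.outNbrs x ∩ A).card = ∑ x ∈ A, (G.outNbrs x).card := by
    rw [cutSize, ← Finset.sum_add_distrib]
    exact Finset.sum_congr rfl fun x _ => Finset.card_sdiff_add_card_inter _ _
  have h4 : G.cutSize Aᶜ + ∑ x ∈ A, (G.inNbrs x ∩ A).card = ∑ x ∈ A, (G.outNbrs x).card := by
    rw [h2, ← Finset.sum_add_distrib]
    refine Finset.sum_congr rfl fun x _ => ?_
    rw [← Finset.sdiff_eq_inter_compl, Finset.card_sdiff_add_card_inter, h]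
  rw [← h1 A A] at h4
  omega

theorem card_lt_card_sdiff_add (hl : ∀ v, ¬ G.Adj v v) {A : Finset V} {x : V} (hx : x ∈ A) :
    (G.outNbrs x).card < (G.outNbrs x \ A).card + A.card := by
  have h1 : (G.outNbrs x ∩ A).card < A.card := by
    refine Finset.card_lt_card ⟨Finset.inter_subset_right, fun h => ?_⟩
    exact hl x (mem_outNbrs.1 (Finset.mem_inter.1 (h hx)).1)
  have h2 := Finset.card_sdiff_add_card_inter (G.outNbrs x) A
  omega

/-- If at most `k` edges leave a set of at least two vertices, and every vertex of it has an
out-neighbour outside, then the set is a clique of size `k` with one such edge at each vertex. -/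
theorem clique_of_cutSize_le (hl : ∀ v, ¬ G.Adj v v) {k : ℕ} (hk : ∀ v, (G.outNbrs v).card = k)
    {A : Finset V} (hA : 2 ≤ A.card) (hcut : G.cutSize A ≤ k)
    (hout : ∀ x ∈ A, ¬ G.outNbrs x ⊆ A) :
    A.card = k ∧ G.cutSize A = k ∧
      ∀ x ∈ A, (G.outNbrs x \ A).card = 1 ∧ A ⊆ insert x (G.outNbrs x) := by
  have h1 : ∀ x ∈ A, 1 ≤ (G.outNbrs x \ A).card := fun x hx =>
    Finset.card_pos.2 (Finset.sdiff_nonempty.2 (hout x hx))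
  have h2 : A.card ≤ G.cutSize A := by
    simpa [cutSize] using Finset.card_nsmul_le_sum A _ 1 h1
  have h3 : A.card * (k + 1 - A.card) ≤ G.cutSize A := by
    refine Finset.card_nsmul_le_sum A _ _ fun x hx => ?_
    have := card_lt_card_sdiff_add hl hx
    rw [hk] at this
    omega
  have hcard : A.card = k := by
    refine le_antisymm (h2.trans hcut) ?_
    by_contra hlt
    obtain ⟨r, hr⟩ : ∃ r, k = A.card + r + 1 := ⟨k - A.card - 1, by omega⟩
    have e : k + 1 - A.card = r + 2 := by omega
    rw [e] at h3
    nlinarith [h3.trans hcut]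
  have hcutk : G.cutSize A = k := by omega
  have hone : ∀ x ∈ A, 1 = (G.outNbrs x \ A).card := by
    refine (Finset.sum_eq_sum_iff_of_le h1).1 ?_
    rw [← cutSize, hcutk]
    simpa using hcard
  refine ⟨hcard, hcutk, fun x hx => ⟨(hone x hx).symm, ?_⟩⟩
  have h4 := Finset.card_sdiff_add_card_inter (G.outNbrs x) A
  rw [hk, ← hone x hx] at h4
  have h5 : insert x (G.outNbrs x ∩ A) = A := by
    refine Finset.eq_of_subset_of_card_le ?_ ?_
    · exact Finset.insert_subset hx Finset.inter_subset_right
    · rw [Finset.card_insert_of_notMem (by simp [hl])]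
      omega
  calc A = insert x (G.outNbrs x ∩ A) := h5.symm
    _ ⊆ _ := Finset.insert_subset_insert _ Finset.inter_subset_left

namespace IsDistanceRegular

variable (hG : G.IsDistanceRegular)
include hG

theorem card_outNbrs_sdiff {u v : V} (h : G.Adj u v) :
    (G.outNbrs v \ insert u (G.outNbrs u)).card = G.forwardNum 1 := by
  have h1 := hG.ddist_eq_one.2 h
  rw [← hG.card_forward one_ne_zero h1]
  congr 1
  ext w
  simp only [Finset.mem_sdiff, mem_outNbrs, Finset.mem_insert, Finset.mem_filter]
  refine and_congr_right fun hvw => ?_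
  have h2 := hG.stronglyConnected.ddist_le_succ u hvw
  rw [← hG.ddist_eq_one, eq_comm, ← hG.stronglyConnected.ddist_eq_zero]
  omega

theorem insert_outNbrs_eq_univ (h0 : G.forwardNum 1 = 0) (u : V) :
    insert u (G.outNbrs u) = Finset.univ := by
  refine hG.stronglyConnected.eq_univ_of_closed (Finset.mem_insert_self _ _) fun x hx => ?_
  rcases Finset.mem_insert.1 hx with rfl | hx
  · exact Finset.subset_insert _ _
  · rw [← Finset.sdiff_eq_empty_iff_subset, ← Finset.card_eq_zero,
      hG.card_outNbrs_sdiff (mem_outNbrs.1 hx), h0]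

/-- If `b 1 = 1` and the valency is at least two, then every edge is present in both directions.
Otherwise no edge is, and then the out-neighbours of a vertex form a clique. -/
theorem symm_of_forwardNum_eq_one {k : ℕ} (hk : ∀ v, (G.outNbrs v).card = k) (hk2 : 2 ≤ k)
    (h1 : G.forwardNum 1 = 1) {u v : V} (h : G.Adj u v) : G.Adj v u := by
  by_contra hvu
  have hanti : ∀ x y, G.Adj x y → ¬ G.Adj y x := by
    intro x y hxy hyx
    have := hG.card_filter_outNbrs_eq 0 (u := u) (v := v) (u' := x) (v' := y)
      (by rw [hG.ddist_eq_one.2 h]; exact one_ne_zero)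
      (by rw [hG.ddist_eq_one.2 h, hG.ddist_eq_one.2 hxy])
    have e : ((G.outNbrs v).filter fun w => G.ddist u w = 0) = ∅ := by
      rw [Finset.filter_eq_empty_iff]
      intro w hw h0
      rw [hG.stronglyConnected.ddist_eq_zero] at h0
      exact hvu (h0 ▸ mem_outNbrs.1 hw)
    rw [e, Finset.card_empty, eq_comm, Finset.card_eq_zero, Finset.filter_eq_empty_iff] at this
    exact this (mem_outNbrs.2 hyx) (ddist_self x)
  have key : ∀ y, G.Adj u y → ∀ z, G.Adj u z → z ≠ y → G.Adj y z := by
    intro y hy z hz hzy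
    have e1 := hG.card_outNbrs_sdiff hy
    rw [Finset.sdiff_insert_of_notMem (by simpa using hanti u y hy), h1] at e1
    have e2 := Finset.card_sdiff_add_card_inter (G.outNbrs y) (G.outNbrs u)
    rw [e1, hk] at e2
    have e3 : G.outNbrs y ∩ G.outNbrs u = (G.outNbrs u).erase y := by
      refine Finset.eq_of_subset_of_card_le (fun w hw => ?_) ?_
      · simp only [Finset.mem_inter, mem_outNbrs, Finset.mem_erase] at hw ⊢
        exact ⟨(hG.ne_of_adj hw.1).symm, hw.2⟩
      · rw [Finset.card_erase_of_mem (mem_outNbrs.2 hy), hk]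
        omega
    have : z ∈ (G.outNbrs u).erase y := by simp [hzy, hz]
    rw [← e3] at this
    exact mem_outNbrs.1 (Finset.mem_inter.1 this).1
  obtain ⟨y, hy, z, hz, hyz⟩ := Finset.one_lt_card.1 (show 1 < (G.outNbrs u).card by rw [hk]; omega)
  rw [mem_outNbrs] at hy hz
  exact hanti y z (key y hy z hz hyz.symm) (key z hz y hy hyz)

/-- If `b 1 = 1` and the valency `k` is at least three, then there are at most `k + 2` vertices: the
digraph is a complete multipartite graph with parts of size two. -/
theorem card_le_of_forwardNum_eq_one {k : ℕ} (hk : ∀ v, (G.outNbrs v).card = k) (hk3 : 3 ≤ k)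
    (h1 : G.forwardNum 1 = 1) (u : V) : Fintype.card V ≤ k + 2 := by
  have hsymm : ∀ {x y : V}, G.Adj x y → G.Adj y x := fun h =>
    hG.symm_of_forwardNum_eq_one hk (by omega) h1 h
  -- For an edge from `x` to `y`, only `x` itself and the unique out-neighbour `w` of `y` at distance
  -- two from `x` are out-neighbours of `y` but not of `x`.
  have hsub : ∀ {x y w z : V}, G.Adj x y → G.Adj y w → w ≠ x → ¬ G.Adj x w → G.Adj y z → z ≠ x →
      z ≠ w → G.Adj x z := by
    intro x y w z hxy hyw hwx hxw hyz hzx hzw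
    by_contra hxz
    have e := hG.card_outNbrs_sdiff hxy
    rw [h1] at e
    exact hzw (Finset.card_le_one.1 e.le z (by simp [*]) w (by simp [*]))
  have hcommon : ∀ {x y : V}, G.Adj x y → ∃ z, G.Adj x z ∧ G.Adj y z := by
    intro x y hxy
    have e := hG.card_outNbrs_sdiff hxy
    have e2 := Finset.card_sdiff_add_card_inter (G.outNbrs y) (insert x (G.outNbrs x))
    have e3 : (insert x (G.outNbrs x) ∩ G.outNbrs y) = insert x (G.outNbrs x ∩ G.outNbrs y) := by
      rw [Finset.insert_inter_of_mem (by simpa using hsymm hxy)]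
    have e4 : x ∉ G.outNbrs x ∩ G.outNbrs y := fun h =>
      hG.loopless x (mem_outNbrs.1 (Finset.mem_inter.1 h).1)
    rw [Finset.inter_comm, e3, Finset.card_insert_of_notMem e4, e, h1, hk] at e2
    obtain ⟨z, hz⟩ := Finset.card_pos.1 (show 0 < (G.outNbrs x ∩ G.outNbrs y).card by omega)
    simp only [Finset.mem_inter, mem_outNbrs] at hz
    exact ⟨z, hz⟩
  obtain ⟨v, hv⟩ := Finset.card_pos.1 (show 0 < (G.outNbrs u).card by rw [hk]; omega)
  rw [mem_outNbrs] at hv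
  obtain ⟨w, hw⟩ := Finset.card_pos.1
    (show 0 < (G.outNbrs v \ insert u (G.outNbrs u)).card by
      rw [hG.card_outNbrs_sdiff hv, h1]; exact one_pos)
  simp only [Finset.mem_sdiff, mem_outNbrs, Finset.mem_insert, not_or] at hw
  obtain ⟨hvw, hwu, huw⟩ := hw
  -- Adjacency to `w` propagates between adjacent out-neighbours of `u`.
  have hprop : ∀ {x y : V}, G.Adj u x → G.Adj x w → G.Adj u y → G.Adj x y → G.Adj y w := by
    intro x y hux hxw huy hxy
    refine hsymm (hsub (hsymm hxw) (hsymm hux) (Ne.symm hwu) (fun h => huw (hsymm h)) hxy ?_ ?_)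
    · rintro rfl; exact huw huy
    · exact (hG.ne_of_adj huy).symm
  have hall : ∀ y, G.Adj u y → G.Adj y w := by
    intro y huy
    by_cases hvy : G.Adj v y
    · exact hprop hv hvw huy hvy
    by_cases hyv : y = v
    · exact hyv ▸ hvw
    obtain ⟨z, huz, hvz⟩ := hcommon hv
    -- Otherwise `v` and `z` would be two out-neighbours of `u` at distance two from `y`.
    have hzy : G.Adj z y := by
      refine hsymm ?_
      by_contra hyz
      have e := hG.card_outNbrs_sdiff (hsymm huy)
      rw [h1] at e
      have hv' : v ∈ G.outNbrs u \ insert y (G.outNbrs y) := by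
        simp only [Finset.mem_sdiff, mem_outNbrs, Finset.mem_insert, not_or]
        exact ⟨hv, Ne.symm hyv, fun h => hvy (hsymm h)⟩
      have hz' : z ∈ G.outNbrs u \ insert y (G.outNbrs y) := by
        simp only [Finset.mem_sdiff, mem_outNbrs, Finset.mem_insert, not_or]
        refine ⟨huz, ?_, hyz⟩
        rintro rfl
        exact hvy hvz
      exact hG.ne_of_adj hvz (Finset.card_le_one.1 e.le v hv' z hz')
    exact hprop huz (hprop hv hvw huz hvz) huy hzy
  have hNw : G.outNbrs u = G.outNbrs w :=
    Finset.eq_of_subset_of_card_le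
      (fun y hy => mem_outNbrs.2 (hsymm (hall y (mem_outNbrs.1 hy)))) (by rw [hk, hk])
  have huniv : insert w (insert u (G.outNbrs u)) = Finset.univ := by
    refine hG.stronglyConnected.eq_univ_of_closed (Finset.mem_insert_self _ _) fun x hx => ?_
    rcases Finset.mem_insert.1 hx with rfl | hx
    · rw [← hNw]
      exact (Finset.subset_insert _ _).trans (Finset.subset_insert _ _)
    rcases Finset.mem_insert.1 hx with rfl | hx
    · exact (Finset.subset_insert _ _).trans (Finset.subset_insert _ _)
    intro y hy
    rw [mem_outNbrs] at hx hy
    simp only [Finset.mem_insert, mem_outNbrs]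
    by_contra! hne
    exact hne.2.2 (hsub hx (hall x hx) hwu huw hy hne.2.1 hne.1)
  rw [← Finset.card_univ, ← huniv]
  have a1 := Finset.card_insert_le w (insert u (G.outNbrs u))
  have a2 := Finset.card_insert_le u (G.outNbrs u)
  rw [hk] at a2
  omega

/-- If at most `k` edges leave a set that has at least two vertices inside and outside, then exactly
`k` do, and `k = 1` or the digraph is an undirected cycle (encoded as `k = 2` and `b 1 = 1`). -/
theorem eq_of_cutSize_le [Nontrivial V] {k : ℕ} (hk : ∀ v, (G.outNbrs v).card = k) {A : Finset V}
    (hA : 2 ≤ A.card) (hA' : 2 ≤ Aᶜ.card) (hcut : G.cutSize A ≤ k) :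
    G.cutSize A = k ∧ (k = 1 ∨ k = 2 ∧ G.forwardNum 1 = 1) := by
  have hcompl := cutSize_compl hG.card_inNbrs_eq
  have hclique : ∀ B : Finset V, 2 ≤ B.card → 2 ≤ Bᶜ.card → G.cutSize B ≤ k →
      (∀ x ∈ B, ¬ G.outNbrs x ⊆ B) → G.cutSize B = k ∧ (k = 1 ∨ k = 2 ∧ G.forwardNum 1 = 1) := by
    intro B hB hB' hcutB hout
    obtain ⟨hcard, hcutk, hcl⟩ := clique_of_cutSize_le hG.loopless hk hB hcutB hout
    refine ⟨hcutk, .inr ?_⟩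
    have hcB := Finset.card_add_card_compl B
    obtain ⟨x, hx, y, hy, hxy⟩ := Finset.one_lt_card.1 hB
    have hadj : G.Adj x y := by
      have := (hcl x hx).2 hy
      rw [Finset.mem_insert, mem_outNbrs] at this
      exact this.resolve_left hxy.symm
    have hb : G.forwardNum 1 ≤ 1 := by
      rw [← hG.card_outNbrs_sdiff hadj, ← (hcl y hy).1]
      exact Finset.card_le_card (Finset.sdiff_subset_sdiff le_rfl (hcl x hx).2)
    rcases Nat.le_one_iff_eq_zero_or_eq_one.1 hb with hb | hb
    · have h1 := congrArg Finset.card (hG.insert_outNbrs_eq_univ hb x)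
      have h2 := Finset.card_insert_le x (G.outNbrs x)
      rw [hk] at h2
      rw [Finset.card_univ] at h1
      omega
    · refine ⟨?_, hb⟩
      by_contra hk2
      have h1 := hG.card_le_of_forwardNum_eq_one hk (by omega) hb x
      have h2 : Bᶜ.card * (k + 1 - Bᶜ.card) ≤ G.cutSize Bᶜ := by
        refine Finset.card_nsmul_le_sum _ _ _ fun z hz => ?_
        have := card_lt_card_sdiff_add hG.loopless hz
        rw [hk] at this
        omega
      rw [hcompl, hcutk, show Bᶜ.card = 2 by omega] at h2
      omega
  by_cases h : ∀ x ∈ A, ¬ G.outNbrs x ⊆ A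
  · exact hclique A hA hA' hcut h
  by_cases h' : ∀ x ∈ Aᶜ, ¬ G.outNbrs x ⊆ Aᶜ
  · have := hclique Aᶜ hA' (by rwa [compl_compl]) (by rwa [hcompl]) h'
    rwa [hcompl] at this
  push Not at h h'
  obtain ⟨a, ha, hNa⟩ := h
  obtain ⟨a', ha', hNa'⟩ := h'
  have e1 := hG.card_compl_mul_le hk ha hNa
  have e2 := hG.card_compl_mul_le hk ha' hNa'
  rw [compl_compl, hcompl] at e2
  have hsum := Finset.card_add_card_compl A
  have hkpos : 0 < k := by
    obtain ⟨x, hx⟩ := exists_ne a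
    obtain ⟨n, hn⟩ := Nat.exists_eq_succ_of_ne_zero
      (fun h0 => hx.symm (hG.stronglyConnected.ddist_eq_zero.1 h0) : G.ddist a x ≠ 0)
    obtain ⟨w, hw, -⟩ := hG.stronglyConnected.exists_first hn
    rw [← hk a, Finset.card_pos]
    exact ⟨w, mem_outNbrs.2 hw⟩
  have hinner : k + 1 ≤ A.card := by
    rw [← hk a, ← Finset.card_insert_of_notMem (a := a) (by simpa using hG.loopless a)]
    exact Finset.card_le_card (Finset.insert_subset ha hNa)
  set n := Fintype.card V
  set e := G.cutSize A
  set b := G.forwardNum 1 with hb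
  have e3 : n * (b * k) + 2 * (e * (k + 1)) ≤ 2 * (e * n) := by
    rw [← hsum] at *
    linarith
  have hnpos : 0 < n := by omega
  have hbpos : 0 < b := by
    rw [Nat.pos_iff_ne_zero]
    intro hb0
    have h1 := hG.insert_outNbrs_eq_univ hb0 a
    have h2 := Finset.card_le_card (Finset.insert_subset ha hNa)
    rw [h1, Finset.card_univ] at h2
    omega
  have hepos : 0 < e := by
    rw [Nat.pos_iff_ne_zero]
    intro he
    have : 0 < n * (b * k) := by positivity
    simp [he] at e3
    omega
  rcases Nat.lt_or_ge b 2 with hb2 | hb2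
  · have hb1 : b = 1 := by omega
    rw [hb1] at e3
    rcases Nat.lt_or_ge k 3 with hk3 | hk3
    · obtain rfl | rfl : k = 1 ∨ k = 2 := by omega
      · exact ⟨by omega, .inl rfl⟩
      · refine ⟨?_, .inr ⟨rfl, hb1⟩⟩
        by_contra he
        have : e = 1 := by omega
        rw [this] at e3
        omega
    · have := hG.card_le_of_forwardNum_eq_one hk hk3 hb1 a
      omega
  · exfalso
    have h1 : e * n ≤ k * n := Nat.mul_le_mul_right _ hcut
    have h2 : n * (2 * k) ≤ n * (b * k) := Nat.mul_le_mul_left _ (Nat.mul_le_mul_right _ hb2)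
    have h3 : 0 < e * (k + 1) := by positivity
    nlinarith

end IsDistanceRegular

end Digraph

/-! ### Undirected cycles and edge cuts -/

namespace Digraph

open scoped Classical

variable {V : Type*} [Fintype V] {G : Digraph V}

/-- A strongly connected digraph of valency two in which every edge is present in both directions is
an undirected cycle: a walk without backtracking returns to its start before it meets any other
vertex again. -/
theorem isUndirectedCycle_of_card_outNbrs_eq_two [Nonempty V] (hl : ∀ v, ¬ G.Adj v v)
    (hc : G.IsStronglyConnected) (hsymm : ∀ u v, G.Adj u v → G.Adj v u)
    (h2 : ∀ v, (G.outNbrs v).card = 2) : G.IsUndirectedCycle := by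
  have hnb : ∀ {x y z w : V}, G.Adj x y → G.Adj x z → y ≠ z → G.Adj x w → w = y ∨ w = z := by
    intro x y z w hy hz hyz hw
    have e : {y, z} = G.outNbrs x :=
      Finset.eq_of_subset_of_card_le (by simp [Finset.insert_subset_iff, hy, hz])
        (by rw [h2, Finset.card_pair hyz])
    have : w ∈ G.outNbrs x := mem_outNbrs.2 hw
    simpa [← e] using this
  have hnext : ∀ x y : V, ∃ z, G.Adj y z ∧ z ≠ x := by
    intro x y
    obtain ⟨z, hz, hzx⟩ := Finset.exists_mem_ne (show 1 < (G.outNbrs y).card by rw [h2]; omega) x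
    exact ⟨z, mem_outNbrs.1 hz, hzx⟩
  choose f hf hfne using hnext
  obtain ⟨p, hadj, hne⟩ : ∃ p : ℕ → V, (∀ i, G.Adj (p i) (p (i + 1))) ∧ ∀ i, p (i + 2) ≠ p i := by
    obtain ⟨a⟩ := ‹Nonempty V›
    let q : ℕ → V × V := fun i => (fun r : V × V => (r.2, f r.1 r.2))^[i] (a, f a a)
    have hq : ∀ i, q (i + 1) = ((q i).2, f (q i).1 (q i).2) := fun i =>
      Function.iterate_succ_apply' _ _ _
    have hqadj : ∀ i, G.Adj (q i).1 (q i).2 := by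
      intro i
      cases i with
      | zero => exact hf a a
      | succ i => rw [hq]; exact hf _ _
    refine ⟨fun i => (q i).1, fun i => ?_, fun i => ?_⟩
    · simp only [hq]; exact hqadj i
    · simp only [hq]; exact hfne _ _
  have hrep : ∃ n, ∃ j, j < n ∧ p j = p n := by
    obtain ⟨i, j, hij, hpij⟩ := Finite.exists_ne_map_eq_of_infinite p
    rcases lt_or_gt_of_ne hij with h | h
    exacts [⟨j, i, h, hpij⟩, ⟨i, j, h, hpij.symm⟩]
  obtain ⟨N, ⟨j, hjN, hpj⟩, hmin⟩ : ∃ N, (∃ j, j < N ∧ p j = p N) ∧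
      ∀ i, i < N → ∀ j, j < i → p j ≠ p i :=
    ⟨Nat.find hrep, Nat.find_spec hrep, fun i hi j hj h => Nat.find_min hrep hi ⟨j, hj, h⟩⟩
  have hinj : ∀ i j, i < N → j < N → p i = p j → i = j := by
    intro i j hi hj h
    by_contra hij
    rcases lt_or_gt_of_ne hij with h' | h'
    exacts [hmin j hj i h' h, hmin i hi j h' h.symm]
  have hsucc : ∀ i, p i ≠ p (i + 1) := fun i h => hl (p (i + 1)) (h ▸ hadj i)
  have hN3 : j + 3 ≤ N := by
    have n1 : N ≠ j + 1 := fun h => hsucc j (h ▸ hpj)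
    have n2 : N ≠ j + 2 := fun h => hne j (h ▸ hpj.symm)
    omega
  -- The first repeated vertex is the start: the two neighbours of a later `p j` are
  -- `p (j - 1)` and `p (j + 1)`, so `p (N - 1)` would be an earlier repetition.
  have hj0 : j = 0 := by
    by_contra h0
    obtain ⟨i, rfl⟩ := Nat.exists_eq_succ_of_ne_zero h0
    obtain ⟨M, rfl⟩ : ∃ M, N = M + 1 := ⟨N - 1, by omega⟩
    have hM : G.Adj (p (i + 1)) (p M) := by
      rw [show p (i + 1) = p (M + 1) from hpj]
      exact hsymm _ _ (hadj M)
    rcases hnb (hsymm _ _ (hadj i)) (hadj (i + 1)) (hne i).symm hM with h | h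
    · have := hinj _ _ (by omega) (by omega) h
      omega
    · have := hinj _ _ (by omega) (by omega) h
      omega
  subst hj0
  obtain ⟨m, rfl⟩ : ∃ m, N = m + 3 := ⟨N - 3, by omega⟩
  let P : Fin (m + 3) → V := fun i => p i
  have hPinj : Function.Injective P := fun i j h => Fin.ext (hinj _ _ i.2 j.2 h)
  have hPadj : ∀ i, G.Adj (P i) (P (i + 1)) := by
    intro i
    simp only [P, Fin.val_add_one]
    split_ifs with h
    · subst h
      rw [hpj]
      exact hadj (m + 2)
    · exact hadj i
  have hPadj' : ∀ i, G.Adj (P i) (P (i - 1)) := by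
    intro i
    have := hPadj (i - 1)
    rw [sub_add_cancel] at this
    exact hsymm _ _ this
  have hPne : ∀ i, P (i + 1) ≠ P (i - 1) := by
    intro i h
    have h1 : i + 1 = i - 1 := hPinj h
    have h3 : i - 1 + (1 + 1) = i - 1 := by rw [← add_assoc, sub_add_cancel, h1]
    have h4 : (1 + 1 : Fin (m + 3)).val = 0 := by rw [add_eq_left.1 h3]; rfl
    rw [Fin.val_add, Fin.val_one, Nat.mod_eq_of_lt (by omega)] at h4
    omega
  have hnbP : ∀ i y, G.Adj (P i) y → y = P (i + 1) ∨ y = P (i - 1) := fun i y hy =>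
    hnb (hPadj i) (hPadj' i) (hPne i) hy
  have hPsurj : Function.Surjective P := by
    intro v
    obtain ⟨n, hn⟩ := hc (P 0) v
    refine hn.mem_of_closed (s := Set.range P) ⟨0, rfl⟩ ?_
    rintro _ ⟨i, rfl⟩ y hy
    rcases hnbP i y hy with rfl | rfl
    exacts [⟨_, rfl⟩, ⟨_, rfl⟩]
  let e := Equiv.ofBijective P ⟨hPinj, hPsurj⟩
  refine ⟨m + 3, by omega, e.symm, fun u v => ?_⟩
  obtain ⟨i, rfl⟩ := e.surjective u
  obtain ⟨l, rfl⟩ := e.surjective v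
  rw [Equiv.symm_apply_apply, Equiv.symm_apply_apply, SimpleGraph.cycleGraph_adj]
  change G.Adj (P i) (P l) ↔ _
  constructor
  · intro h
    rcases hnbP i _ h with h | h
    · exact .inr (by rw [hPinj h, add_sub_cancel_left])
    · exact .inl (by rw [hPinj h, sub_sub_cancel])
  · rintro (h | h)
    · rw [← sub_sub_cancel i l, h]
      exact hPadj' i
    · rw [← add_sub_cancel i l, h]
      exact hPadj i

/-- The edges from a set of vertices to its complement. -/
def boundaryArcs (G : Digraph V) (A : Finset V) : Set (V × V) :=
  {e | G.Adj e.1 e.2 ∧ e.1 ∈ A ∧ e.2 ∉ A}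

theorem ncard_boundaryArcs (A : Finset V) : (G.boundaryArcs A).ncard = G.cutSize A := by
  have : G.boundaryArcs A = (A.sigma fun x => G.outNbrs x \ A).map
      (Equiv.sigmaEquivProd V V).toEmbedding := by
    ext ⟨x, y⟩
    simp only [boundaryArcs, Set.mem_ofPred_eq, Finset.coe_map, Set.mem_image, Finset.mem_coe,
      Finset.mem_sigma, Finset.mem_sdiff, mem_outNbrs, Equiv.coe_toEmbedding]
    constructor
    · rintro ⟨h1, h2, h3⟩
      exact ⟨⟨x, y⟩, ⟨h2, h1, h3⟩, rfl⟩
    · rintro ⟨⟨x', y'⟩, ⟨h2, h1, h3⟩, h⟩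
      cases h
      exact ⟨h1, h2, h3⟩
  rw [this, Set.ncard_coe_finset, Finset.card_map, Finset.card_sigma, cutSize]

/-- An edge cut contains all edges leaving some proper nonempty set of vertices, namely the set of
vertices that can still be reached from a suitable vertex. -/
theorem IsEdgeCut.exists_boundaryArcs_subset {F : Set (V × V)} (hF : G.IsEdgeCut F) :
    ∃ A : Finset V, A.Nonempty ∧ Aᶜ.Nonempty ∧ G.boundaryArcs A ⊆ F := by
  have h := hF.2
  simp only [IsStronglyConnected, not_forall] at h
  obtain ⟨u, v, huv⟩ := h
  refine ⟨Finset.univ.filter fun w => ∃ n, (G.removeArcs F).HasWalk n u w,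
    ⟨u, by simpa using ⟨0, rfl⟩⟩, ⟨v, by simpa using huv⟩, ?_⟩
  rintro ⟨x, y⟩ ⟨hxy, hx, hy⟩
  simp only [Finset.mem_filter, Finset.mem_univ, true_and] at hx hy
  by_contra hn
  obtain ⟨n, hx⟩ := hx
  exact hy ⟨n + 1, hx.trans (hasWalk_one.2 ⟨hxy, hn⟩)⟩

theorem isEdgeCut_boundaryArcs {A : Finset V} (hA : A.Nonempty) (hA' : Aᶜ.Nonempty) :
    G.IsEdgeCut (G.boundaryArcs A) := by
  refine ⟨fun e he => he.1, fun h => ?_⟩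
  have := h.eq_univ_of_closed hA.choose_spec fun x hx y hy => ?_
  · simp [this] at hA'
  · rw [mem_outNbrs] at hy
    by_contra hyA
    exact hy.2 ⟨hy.1, hx, hyA⟩

omit [Fintype V] in
theorem boundaryArcs_singleton (hl : ∀ v, ¬ G.Adj v v) (x : V) :
    G.boundaryArcs {x} = G.outArcs x := by
  ext ⟨y, z⟩
  simp only [boundaryArcs, outArcs, arcSet, Set.mem_ofPred_eq, Finset.mem_singleton]
  refine and_congr_right fun h => and_iff_left_of_imp ?_
  rintro rfl rfl
  exact hl _ h

theorem boundaryArcs_compl_singleton (hl : ∀ v, ¬ G.Adj v v) (x : V) :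
    G.boundaryArcs {x}ᶜ = G.inArcs x := by
  ext ⟨y, z⟩
  simp only [boundaryArcs, inArcs, arcSet, Set.mem_ofPred_eq, Finset.mem_compl,
    Finset.mem_singleton, not_not]
  refine and_congr_right fun h => and_iff_right_of_imp ?_
  rintro rfl rfl
  exact hl _ h

theorem cutSize_singleton (hl : ∀ v, ¬ G.Adj v v) (x : V) :
    G.cutSize {x} = (G.outNbrs x).card := by
  rw [cutSize, Finset.sum_singleton, Finset.sdiff_singleton_eq_erase,
    Finset.erase_eq_of_notMem (by simpa using hl x)]

/-- The edges leaving `A` number at least `k`, and the cases of equality. The case `k = 1` occurs in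
directed cycles, where every single edge is a cut. -/
theorem IsDistanceRegular.le_cutSize [Nontrivial V] (hG : G.IsDistanceRegular) {k : ℕ}
    (hk : ∀ v, (G.outNbrs v).card = k) {A : Finset V} (hA : A.Nonempty) (hA' : Aᶜ.Nonempty) :
    k ≤ G.cutSize A ∧ (G.cutSize A = k →
      (∃ x, A = {x} ∨ A = {x}ᶜ) ∨ k = 1 ∨ k = 2 ∧ G.forwardNum 1 = 1) := by
  have h1 := hA.card_pos
  have h1' := hA'.card_pos
  rcases Nat.lt_or_ge A.card 2 with h | h
  · obtain ⟨x, rfl⟩ := Finset.card_eq_one.1 (show A.card = 1 by omega)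
    exact ⟨by rw [cutSize_singleton hG.loopless, hk], fun _ => .inl ⟨x, .inl rfl⟩⟩
  rcases Nat.lt_or_ge Aᶜ.card 2 with h' | h'
  · obtain ⟨x, hx⟩ := Finset.card_eq_one.1 (show Aᶜ.card = 1 by omega)
    have hAx : A = {x}ᶜ := by rw [← hx, compl_compl]
    refine ⟨?_, fun _ => .inl ⟨x, .inr hAx⟩⟩
    rw [hAx, cutSize_compl hG.card_inNbrs_eq, cutSize_singleton hG.loopless, hk]
  rcases le_or_gt (G.cutSize A) k with hc | hc
  · have := hG.eq_of_cutSize_le hk h h' hc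
    exact ⟨this.1.ge, fun _ => .inr this.2⟩
  · exact ⟨hc.le, fun h => absurd h hc.ne'⟩

end Digraph

theorem theorem2p4 {V : Type*} [Finite V] [Nontrivial V] (G : Digraph V)
    (hG : G.IsDistanceRegular) :
    (∃ k : ℕ, G.IsRegularOfValency k ∧ G.edgeConnectivity = k) ∧
      (¬ G.IsUndirectedCycle →
        ∀ F : Set (V × V), G.IsMinEdgeCut F →
          ∃ x : V, F = G.inArcs x ∨ F = G.outArcs x) := by
  classical
  obtain ⟨_⟩ := nonempty_fintype V
  obtain ⟨a, b, hab⟩ := exists_pair_ne V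
  obtain ⟨k, hk⟩ : ∃ k, ∀ v, (G.outNbrs v).card = k :=
    ⟨(G.outNbrs a).card, fun v => hG.card_outNbrs_eq v a⟩
  have hcut : ∀ x, G.IsEdgeCut (G.outArcs x) ∧ (G.outArcs x).ncard = k := by
    intro x
    rw [← Digraph.boundaryArcs_singleton hG.loopless, Digraph.ncard_boundaryArcs,
      Digraph.cutSize_singleton hG.loopless, hk]
    refine ⟨Digraph.isEdgeCut_boundaryArcs (Finset.singleton_nonempty x) ?_, rfl⟩
    obtain ⟨y, hy⟩ := exists_ne x
    exact ⟨y, by simpa using hy⟩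
  have hle : ∀ F, G.IsEdgeCut F → k ≤ F.ncard := by
    intro F hF
    obtain ⟨A, hA, hA', hAF⟩ := hF.exists_boundaryArcs_subset
    refine (hG.le_cutSize hk hA hA').1.trans ?_
    rw [← Digraph.ncard_boundaryArcs]
    exact Set.ncard_le_ncard hAF (Set.toFinite F)
  refine ⟨⟨k, fun v => ⟨?_, ?_⟩, ?_⟩, fun hcyc F hF => ?_⟩
  · rw [← hk v, ← Set.ncard_coe_finset]
    congr 1
    ext w
    simp
  · rw [← hk v, ← hG.card_inNbrs_eq, ← Set.ncard_coe_finset]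
    congr 1
    ext w
    simp
  · refine IsLeast.csInf_eq ⟨⟨_, hcut a⟩, ?_⟩
    rintro _ ⟨F, hF, rfl⟩
    exact hle F hF
  · have hFk : F.ncard = k :=
      le_antisymm ((hF.2 _ (hcut a).1).trans (hcut a).2.le) (hle F hF.1)
    obtain ⟨A, hA, hA', hAF⟩ := hF.1.exists_boundaryArcs_subset
    have hlow := hG.le_cutSize hk hA hA'
    have hAF' : G.boundaryArcs A = F := by
      refine Set.eq_of_subset_of_ncard_le hAF ?_ (Set.toFinite F)
      rw [hFk, Digraph.ncard_boundaryArcs]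
      exact hlow.1
    have hcutk : G.cutSize A = k := by rw [← Digraph.ncard_boundaryArcs, hAF', hFk]
    rcases hlow.2 hcutk with ⟨x, rfl | rfl⟩ | rfl | ⟨rfl, hb⟩
    · exact ⟨x, .inr (by rw [← hAF', Digraph.boundaryArcs_singleton hG.loopless])⟩
    · exact ⟨x, .inl (by rw [← hAF', Digraph.boundaryArcs_compl_singleton hG.loopless])⟩
    · -- For valency one, the only edge of `F` is the only edge out of its tail.
      obtain ⟨⟨x, y⟩, he⟩ := Set.ncard_eq_one.1 hFk
      have hxy : (x, y) ∈ F := he ▸ Set.mem_singleton _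
      refine ⟨x, .inr (Set.eq_of_subset_of_ncard_le ?_ ?_ (Set.toFinite _))⟩
      · rw [he, Set.singleton_subset_iff]
        exact ⟨hF.1.1 hxy, rfl⟩
      · rw [hFk, (hcut x).2]
    · exact absurd (Digraph.isUndirectedCycle_of_card_outNbrs_eq_two hG.loopless
        hG.stronglyConnected (fun u v => hG.symm_of_forwardNum_eq_one hk le_rfl hb) hk) hcyc
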